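/- All graphs are finite and simple; eigenvalues, eigenvectors and eigenspaces of a graph are those of its real adjacency matrix, and an eigenvector is nonzero by definition. For a graph $G$ and $\lambda\in\mathbb R$ let $N_\lambda(G)$ be the set of vertices on which every eigenvector of $G$ for $\lambda$ vanishes, and let $G\setminus M$ denote the graph obtained from $G$ by deleting the vertices in $M$ together with all incident edges. Let $\mathcal C$ be the class of trees that have an eigenvector for eigenvalue $1$ with all entries in $\{1,-1\}$, and let $\mathcal C_{-}$ be the class of trees that have an eigenvector for eigenvalue $-1$ with all entries in $\{1,-1\}$. Theorem. Let $T$ be a tree. (a) If $1$ is an eigenvalue of $T$, then the eigenspace of $T$ for eigenvalue $1$ has a basis consisting of vectors with entries in $\{0,1,-1\}$ if and only if every connected component of $T\setminus N_1(T)$ belongs to $\mathcal C$. (b) If $-1$ is an eigenvalue of $T$, then the following are equivalent: the eigenspace of $T$ for eigenvalue $-1$ has a basis consisting of vectors with entries in $\{0,1,-1\}$; every connected component of $T\setminus N_1(T)$ belongs to $\mathcal C$; every connected component of $T\setminus N_{-1}(T)$ belongs to $\mathcal C_{-}$. -/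

import Mathlib

namespace TreeEigen

universe u

/-- The adjacency matrix of a finite simple graph, as an endomorphism of `ℝ^V`. -/
noncomputable def adjEnd {V : Type u} [Finite V] (G : SimpleGraph V) : Module.End ℝ (V → ℝ) :=
  letI := Fintype.ofFinite V
  letI := Classical.decRel G.Adj
  (G.adjMatrix ℝ).mulVecLin

/-- The eigenspace of a graph for `μ` (`⊥` if `μ` is not an eigenvalue). -/
noncomputable def eigsp {V : Type u} [Finite V] (G : SimpleGraph V) (μ : ℝ) :
    Submodule ℝ (V → ℝ) :=
  Module.End.eigenspace (adjEnd G) μ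

/-- `N_μ(G)`: the vertices on which every eigenvector of `G` for `μ` vanishes. -/
def alwaysZero {V : Type u} [Finite V] (G : SimpleGraph V) (μ : ℝ) : Set V :=
  {v | ∀ x : V → ℝ, Module.End.HasEigenvector (adjEnd G) μ x → x v = 0}

/-- `G ∖ M`: remove the vertices of `M` and all edges incident with them. -/
abbrev removeVerts {V : Type u} (G : SimpleGraph V) (M : Set V) : SimpleGraph ↥(Mᶜ) :=
  G.induce Mᶜ

/-- The eigenspace of `G` for `μ` has a basis all of whose vectors have entries in `{0, 1, -1}`. -/
def HasSimplyStructuredBasis {V : Type u} [Finite V] (G : SimpleGraph V) (μ : ℝ) : Prop :=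
  ∃ b : Module.Basis (Fin (Module.finrank ℝ (eigsp G μ))) ℝ (eigsp G μ),
    ∀ i v, (b i : V → ℝ) v ∈ ({0, 1, -1} : Set ℝ)

/-- Trees with an eigenvector for `μ` all of whose entries lie in `{1, -1}`;
the class `𝒞` is the case `μ = 1`. -/
def InSignClass {V : Type u} [Finite V] (G : SimpleGraph V) (μ : ℝ) : Prop :=
  G.IsTree ∧ ∃ x : V → ℝ, Module.End.HasEigenvector (adjEnd G) μ x ∧
    ∀ v, x v ∈ ({1, -1} : Set ℝ)

/-- The class `𝒞` of all trees with a `{1, -1}` eigenvector for eigenvalue `1`. -/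
def InClassC {V : Type u} [Finite V] (G : SimpleGraph V) : Prop :=
  InSignClass G 1

end TreeEigen

/-!
In a forest every edge `uv` is a bridge. If `B` is the side of `u`, the adjacency operator `A`
satisfies `A (1_B x) - 1_B (A x) = x u • δ_v - x v • δ_u`. Pairing this identity with a second
eigenvector shows that eigenvectors for the same eigenvalue are proportional along every edge.
Hence an eigenvector that is nonzero somewhere on a component of `T ∖ N` is nonzero on all of it,
and the vectors of a `{0, 1, -1}` basis restrict to `{1, -1}` eigenvectors of the components.

Conversely, if every component has a `{1, -1}` eigenvector, then the entries of any eigenvector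
agree in modulus along edges with both ends in its support. The eigenspace is spanned by its
vectors `x` of minimal support. If such an `x` vanishes at `v` but not at two neighbours of `v`,
then combining the truncations of `x` to the branches at these neighbours gives an eigenvector; by
minimality all other neighbours of `v` are zeros of `x`, so the two entries are opposite. The
restriction of `x` to a level set of `|x|` is therefore again an eigenvector, and by minimality
`|x|` is constant on the support.

Changing signs on one colour class of a bipartite graph exchanges the eigenvalues `μ` and `-μ`.
-/

namespace TreeEigen

open SimpleGraph Function

section LinearAlgebra

variable {K ι M : Type*}

lemma exists_basis_mem_iff_span_inter_eq [DivisionRing K] [AddCommGroup M] [Module K M]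
    (S : Submodule K M) [Module.Finite K S] (t : Set M) :
    (∃ b : Module.Basis (Fin (Module.finrank K S)) K S, ∀ i, (b i : M) ∈ t) ↔
      Submodule.span K (S ∩ t) = S := by
  constructor
  · rintro ⟨b, hb⟩
    refine le_antisymm (Submodule.span_le.2 Set.inter_subset_left) ?_
    calc S = (Submodule.span K (Set.range b)).map S.subtype := by
          rw [b.span_eq, Submodule.map_subtype_top]
      _ ≤ Submodule.span K (S ∩ t) := by
          rw [Submodule.map_span, ← Set.range_comp]
          exact Submodule.span_mono (Set.range_subset_iff.2 fun i => ⟨(b i).2, hb i⟩)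
  · intro hspan
    have htop : ⊤ ≤ Submodule.span K (S.subtype ⁻¹' t) := by
      rw [← Submodule.map_le_map_iff_of_injective S.injective_subtype, Submodule.map_span,
        Submodule.map_subtype_top, Set.image_preimage_eq_range_inter, Submodule.coe_subtype,
        Subtype.range_coe]
      exact hspan.ge
    let b := Module.Basis.ofSpan htop
    refine ⟨b.reindex (b.indexEquiv (Module.finBasis K S)), fun i => ?_⟩
    rw [Module.Basis.reindex_apply]
    exact Module.Basis.ofSpan_subset htop ⟨_, rfl⟩

/-- The elementary vectors of a space of functions (in the sense of Rockafellar): its nonzero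
members with inclusion-minimal support. -/
def IsElementary [Semiring K] (S : Submodule K (ι → K)) (x : ι → K) : Prop :=
  MinimalFor (fun y => y ∈ S ∧ y ≠ 0) support x

lemma exists_isElementary_support_subset [Semiring K] [Finite ι] {S : Submodule K (ι → K)}
    {x : ι → K} (hx : x ∈ S) (hx0 : x ≠ 0) :
    ∃ y, IsElementary S y ∧ support y ⊆ support x := by
  obtain ⟨y, ⟨hy, hyx⟩, hmin⟩ := exists_minimalFor_of_wellFoundedLT
    (fun y => (y ∈ S ∧ y ≠ 0) ∧ support y ⊆ support x) support ⟨x, ⟨hx, hx0⟩, subset_rfl⟩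
  exact ⟨y, ⟨hy, fun z hz hzy => hmin ⟨hz, hzy.trans hyx⟩ hzy⟩, hyx⟩

lemma span_isElementary [DivisionRing K] [Finite ι] (S : Submodule K (ι → K)) :
    Submodule.span K {x | IsElementary S x} = S := by
  refine le_antisymm (Submodule.span_le.2 fun x (hx : IsElementary S x) => hx.prop.1)
    fun x hx => ?_
  induction hs : support x using WellFoundedLT.induction generalizing x with
  | ind s ih =>
  subst hs
  obtain rfl | hx0 := eq_or_ne x 0
  · exact zero_mem _
  obtain ⟨e, he, hex⟩ := exists_isElementary_support_subset hx hx0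
  obtain ⟨i, hi⟩ := support_nonempty_iff.2 he.prop.2
  have hi0 : (x - (x i / e i) • e) i = 0 := by simp [div_mul_cancel₀ _ (mem_support.1 hi)]
  have hsub : support (x - (x i / e i) • e) ⊆ support x := fun j hj hxj =>
    hj (by simp [hxj, notMem_support.1 (mt (@hex j) (notMem_support.2 hxj))])
  have hrest := ih _ ⟨hsub, fun h => h (hex hi) hi0⟩ (x := x - (x i / e i) • e)
    (S.sub_mem hx (S.smul_mem _ he.prop.1)) rfl
  simpa using Submodule.add_mem _ hrest
    (Submodule.smul_mem _ (x i / e i) (Submodule.subset_span he))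

end LinearAlgebra

section SignVectors

variable {V : Type*}

/-- The vectors with all entries in `{0, 1, -1}`. -/
def signVectors (V : Type*) : Set (V → ℝ) :=
  {x | ∀ v, x v ∈ ({0, 1, -1} : Set ℝ)}

lemma exists_smul_mem_signVectors {x : V → ℝ}
    (hx : ∀ u v, x u ≠ 0 → x v ≠ 0 → |x u| = |x v|) : ∃ a : ℝ, a ≠ 0 ∧ a • x ∈ signVectors V := by
  by_cases h0 : ∀ v, x v = 0
  · exact ⟨1, one_ne_zero, fun v => by simp [h0 v]⟩
  push Not at h0
  obtain ⟨r, hr⟩ := h0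
  refine ⟨|x r|⁻¹, inv_ne_zero (abs_ne_zero.2 hr), fun v => ?_⟩
  by_cases hv : x v = 0
  · simp [hv]
  · have habs : |(|x r|⁻¹ • x) v| = 1 := by
      simp [hx r v hr hv, abs_mul, inv_mul_cancel₀ (abs_ne_zero.2 hv)]
    exact Or.inr (eq_or_eq_neg_of_abs_eq habs)

lemma mul_mem_signVectors {x y : V → ℝ} (hx : x ∈ signVectors V) (hy : y ∈ signVectors V) :
    x * y ∈ signVectors V := fun v => by
  rcases hx v with h | h | (h : x v = -1) <;> rcases hy v with h' | h' | (h' : y v = -1) <;>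
    simp [h, h']

lemma hasSimplyStructuredBasis_iff_span_eq [Finite V] {G : SimpleGraph V} {μ : ℝ} :
    HasSimplyStructuredBasis G μ ↔
      Submodule.span ℝ (eigsp G μ ∩ signVectors V) = eigsp G μ :=
  exists_basis_mem_iff_span_inter_eq (eigsp G μ) (signVectors V)

end SignVectors

section AdjacencyOperator

variable {V : Type*} {G : SimpleGraph V} {μ : ℝ} {x : V → ℝ}

lemma adjEnd_apply [Fintype V] [DecidableRel G.Adj] (x : V → ℝ) (v : V) :
    adjEnd G x v = ∑ u ∈ G.neighborFinset v, x u := by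
  rw [← adjMatrix_mulVec_apply]
  simp only [adjEnd, Matrix.mulVecLin_apply]
  congr!

lemma dotProduct_adjEnd [Fintype V] (x y : V → ℝ) :
    x ⬝ᵥ adjEnd G y = adjEnd G x ⬝ᵥ y := by
  classical
  have hmul : ∀ z, adjEnd G z = (G.adjMatrix ℝ).mulVec z := fun z => funext fun v => by
    rw [adjEnd_apply, adjMatrix_mulVec_apply]
  rw [hmul, hmul, Matrix.dotProduct_mulVec, ← Matrix.mulVec_transpose, transpose_adjMatrix]

variable [Finite V]

lemma adjEnd_apply_congr {x y : V → ℝ} {v : V} (h : ∀ u, G.Adj v u → x u = y u) :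
    adjEnd G x v = adjEnd G y v := by
  classical
  cases nonempty_fintype V
  rw [adjEnd_apply, adjEnd_apply]
  exact Finset.sum_congr rfl fun u hu => h u ((mem_neighborFinset ..).1 hu)

lemma adjEnd_single_apply_of_adj [DecidableEq V] {u v : V} (h : G.Adj v u) (a : ℝ) :
    adjEnd G (Pi.single u a) v = a := by
  classical
  cases nonempty_fintype V
  rw [adjEnd_apply, Finset.sum_eq_single_of_mem u ((mem_neighborFinset ..).2 h), Pi.single_eq_same]
  exact fun w _ hw => by simp [hw]

lemma adjEnd_comp_embedding_apply {W : Type*} [Finite W] {H : SimpleGraph W} (f : H ↪g G) {a : W}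
    (h0 : ∀ v, G.Adj (f a) v → v ∉ Set.range f → x v = 0) :
    adjEnd H (x ∘ f) a = adjEnd G x (f a) := by
  classical
  cases nonempty_fintype V
  cases nonempty_fintype W
  rw [adjEnd_apply, adjEnd_apply]
  refine Finset.sum_of_injOn f f.injective.injOn (fun b hb => ?_) (fun v hv hvf => ?_)
    fun b _ => rfl
  · simpa using hb
  · refine h0 v (by simpa using hv) ?_
    rintro ⟨b, rfl⟩
    exact hvf ⟨b, by simpa using hv, rfl⟩

lemma mem_eigsp_iff : x ∈ eigsp G μ ↔ ∀ v, adjEnd G x v = μ * x v := by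
  rw [eigsp, Module.End.mem_eigenspace_iff, funext_iff]
  rfl

lemma notMem_alwaysZero_iff {v : V} : v ∉ alwaysZero G μ ↔ ∃ x ∈ eigsp G μ, x v ≠ 0 := by
  simp only [alwaysZero, Set.mem_ofPred_eq, not_forall, exists_prop]
  constructor
  · rintro ⟨x, hx, hv⟩
    exact ⟨x, hx.1, hv⟩
  · rintro ⟨x, hx, hv⟩
    exact ⟨x, ⟨hx, fun h => hv (congrFun h v)⟩, hv⟩

lemma indicator_mem_eigsp (hx : x ∈ eigsp G μ) {S : Set V}
    (hS : ∀ v, (∀ u, u = v ∨ G.Adj v u → x u ≠ 0 → u ∈ S) ∨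
      ∀ u, u = v ∨ G.Adj v u → x u ≠ 0 → u ∉ S) :
    S.indicator x ∈ eigsp G μ := by
  rw [mem_eigsp_iff] at hx ⊢
  intro v
  rcases hS v with hin | hout
  · have hagree : ∀ u, u = v ∨ G.Adj v u → S.indicator x u = x u := fun u hu =>
      Set.indicator_apply_eq_self.2 fun huS => by_contra fun h => huS (hin u hu h)
    rw [adjEnd_apply_congr fun u hu => hagree u (.inr hu), hagree v (.inl rfl), hx]
  · have hvanish : ∀ u, u = v ∨ G.Adj v u → S.indicator x u = 0 := fun u hu =>
      Set.indicator_apply_eq_zero.2 fun huS => by_contra fun h => hout u hu h huS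
    rw [adjEnd_apply_congr (y := 0) fun u hu => hvanish u (.inr hu), hvanish v (.inl rfl), map_zero,
      mul_zero, Pi.zero_apply]

end AdjacencyOperator

section Bridges

variable {V : Type*} {G : SimpleGraph V} {u v : V}

/-- The part of `G` on the side of `u` after the edge `uv` is removed. -/
def branch (G : SimpleGraph V) (u v : V) : Set V :=
  {w | (G.deleteEdges {s(u, v)}).Reachable u w}

lemma left_mem_branch (G : SimpleGraph V) (u v : V) : u ∈ branch G u v := Reachable.refl _

lemma right_notMem_branch (hb : G.IsBridge s(u, v)) : v ∉ branch G u v := isBridge_iff.1 hb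

lemma eq_and_eq_of_adj_of_mem_branch {w z : V} (hw : w ∈ branch G u v) (hz : z ∉ branch G u v)
    (hwz : G.Adj w z) : w = u ∧ z = v := by
  by_cases he : s(w, z) = s(u, v)
  · rcases Sym2.eq_iff.1 he with h | ⟨-, rfl⟩
    · exact h
    · exact absurd (left_mem_branch G z v) hz
  · refine absurd (Reachable.trans hw (Adj.reachable ?_)) hz
    exact (deleteEdges_adj ..).2 ⟨hwz, by simpa using he⟩

lemma notMem_branch_of_adj_right (hb : G.IsBridge s(u, v)) {w : V} (hw : G.Adj w v) (hne : w ≠ u) :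
    w ∉ branch G u v := fun hmem =>
  hne (eq_and_eq_of_adj_of_mem_branch hmem (right_notMem_branch hb) hw).1

variable [Finite V] {μ : ℝ} {x y : V → ℝ}

/- Only the edge `uv` crosses the cut, so restricting to the branch commutes with the adjacency
operator away from `u` and `v`. -/
lemma adjEnd_indicator_branch [DecidableEq V] (hb : G.IsBridge s(u, v)) (h : G.Adj u v)
    (x : V → ℝ) :
    adjEnd G ((branch G u v).indicator x) =
      (branch G u v).indicator (adjEnd G x) + Pi.single v (x u) - Pi.single u (x v) := by
  have hu := left_mem_branch G u v
  have hv := right_notMem_branch hb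
  funext w
  simp only [Pi.add_apply, Pi.sub_apply]
  obtain rfl | hwu := eq_or_ne w u
  · have hcut : ∀ z, G.Adj w z →
        (branch G w v).indicator x z = (x - Pi.single v (x v) : V → ℝ) z := by
      intro z hz
      by_cases hzB : z ∈ branch G w v
      · simp [hzB, ne_of_mem_of_not_mem hzB hv]
      · simp [(eq_and_eq_of_adj_of_mem_branch hu hzB hz).2, hv]
    rw [adjEnd_apply_congr hcut, map_sub, Pi.sub_apply, adjEnd_single_apply_of_adj h]
    simp [hu, h.ne]
  obtain rfl | hwv := eq_or_ne w v
  · have hcut : ∀ z, G.Adj w z →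
        (branch G u w).indicator x z = (Pi.single u (x u) : V → ℝ) z := by
      intro z hz
      obtain rfl | hzu := eq_or_ne z u
      · simp [hu]
      · simp [notMem_branch_of_adj_right hb hz.symm hzu, hzu]
    rw [adjEnd_apply_congr hcut, adjEnd_single_apply_of_adj h.symm]
    simp [hv, h.ne']
  by_cases hw : w ∈ branch G u v
  · have hcut : ∀ z, G.Adj w z → (branch G u v).indicator x z = x z := fun z hz =>
      Set.indicator_of_mem (by_contra fun hzB =>
        hwu (eq_and_eq_of_adj_of_mem_branch hw hzB hz).1) _
    rw [adjEnd_apply_congr hcut]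
    simp [hw, hwu, hwv]
  · have hcut : ∀ z, G.Adj w z → (branch G u v).indicator x z = (0 : V → ℝ) z := fun z hz =>
      Set.indicator_of_notMem (fun hzB =>
        hwv (eq_and_eq_of_adj_of_mem_branch hzB hw hz.symm).2) _
    rw [adjEnd_apply_congr hcut]
    simp [hw, hwu, hwv]

lemma adjEnd_indicator_branch_of_mem_eigsp [DecidableEq V] (hb : G.IsBridge s(u, v))
    (h : G.Adj u v) (hx : x ∈ eigsp G μ) :
    adjEnd G ((branch G u v).indicator x) =
      μ • (branch G u v).indicator x + Pi.single v (x u) - Pi.single u (x v) := by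
  rw [adjEnd_indicator_branch hb h, Module.End.mem_eigenspace_iff.1 hx]
  exact congrArg (· + _ - _) (Set.indicator_const_smul _ μ x)

lemma mul_eq_mul_of_isBridge (hb : G.IsBridge s(u, v)) (h : G.Adj u v) (hx : x ∈ eigsp G μ)
    (hy : y ∈ eigsp G μ) : x u * y v = x v * y u := by
  classical
  cases nonempty_fintype V
  have hsymm := dotProduct_adjEnd (G := G) y ((branch G u v).indicator x)
  rw [adjEnd_indicator_branch_of_mem_eigsp hb h hx, Module.End.mem_eigenspace_iff.1 hy,
    dotProduct_sub, dotProduct_add, dotProduct_smul, smul_dotProduct, dotProduct_single,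
    dotProduct_single] at hsymm
  linarith

lemma smul_indicator_branch_sub_mem_eigsp {u' : V} (hb : G.IsBridge s(u, v)) (h : G.Adj u v)
    (hb' : G.IsBridge s(u', v)) (h' : G.Adj u' v) (hx : x ∈ eigsp G μ) (hv : x v = 0) :
    x u' • (branch G u v).indicator x - x u • (branch G u' v).indicator x ∈ eigsp G μ := by
  classical
  have hcomm : x u' • (Pi.single v (x u) : V → ℝ) = x u • Pi.single v (x u') := by
    rw [← Pi.single_smul, ← Pi.single_smul, smul_eq_mul, smul_eq_mul, mul_comm]
  rw [eigsp, Module.End.mem_eigenspace_iff, map_sub, map_smul, map_smul,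
    adjEnd_indicator_branch_of_mem_eigsp hb h hx, adjEnd_indicator_branch_of_mem_eigsp hb' h' hx,
    hv, Pi.single_zero, Pi.single_zero, sub_zero, sub_zero, smul_add, smul_add, hcomm]
  module

end Bridges

section ElementaryEigenvectors

variable {V : Type*} [Finite V] {G : SimpleGraph V} {μ : ℝ} {x : V → ℝ}

/- Combining the branches at `u` and `u'` gives an eigenvector whose support contains no other
neighbour of `v`, so by minimality `u` and `u'` are the only neighbours of `v` in the support. -/
lemma IsElementary.apply_eq_neg_of_adj_zero (hG : G.IsAcyclic) (hx : IsElementary (eigsp G μ) x)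
    {u u' v : V} (h : G.Adj u v) (h' : G.Adj u' v) (hne : u ≠ u') (hv : x v = 0) (hu : x u ≠ 0)
    (hu' : x u' ≠ 0) : x u = -x u' := by
  classical
  have hb := isAcyclic_iff_forall_adj_isBridge.1 hG h
  have hb' := isAcyclic_iff_forall_adj_isBridge.1 hG h'
  set y := x u' • (branch G u v).indicator x - x u • (branch G u' v).indicator x with hy
  have hymem : y ∈ eigsp G μ := smul_indicator_branch_sub_mem_eigsp hb h hb' h' hx.prop.1 hv
  have hyu : y u ≠ 0 := by
    simp [hy, left_mem_branch, notMem_branch_of_adj_right hb' h hne, hu, hu']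
  have hyx : support y ⊆ support x := fun w hw hxw => hw (by simp [hy, Set.indicator_apply, hxw])
  have hxy : support x ⊆ support y := hx.le_of_le ⟨hymem, fun h0 => hyu (congrFun h0 u)⟩ hyx
  have hother : ∀ w, G.Adj v w → w ≠ u → w ≠ u' → x w = 0 := fun w hw hwu hwu' =>
    by_contra fun hxw => hxy hxw (by
      simp [hy, notMem_branch_of_adj_right hb hw.symm hwu,
        notMem_branch_of_adj_right hb' hw.symm hwu'])
  have hnbrs : ∀ w, G.Adj v w → x w = (Pi.single u (x u) + Pi.single u' (x u') : V → ℝ) w := by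
    intro w hw
    obtain rfl | hwu := eq_or_ne w u
    · simp [hne]
    obtain rfl | hwu' := eq_or_ne w u'
    · simp [hwu]
    · simp [hwu, hwu', hother w hw hwu hwu']
  have hsum := mem_eigsp_iff.1 hx.prop.1 v
  rw [adjEnd_apply_congr hnbrs, map_add, Pi.add_apply, adjEnd_single_apply_of_adj h.symm,
    adjEnd_single_apply_of_adj h'.symm, hv, mul_zero] at hsum
  exact eq_neg_of_add_eq_zero_left hsum

lemma IsElementary.abs_eq_abs (hG : G.IsAcyclic) (hx : IsElementary (eigsp G μ) x)
    (hedge : ∀ u v, G.Adj u v → x u ≠ 0 → x v ≠ 0 → |x u| = |x v|) {r s : V} (hr : x r ≠ 0)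
    (hs : x s ≠ 0) : |x r| = |x s| := by
  let L : Set V := {w | |x w| = |x r|}
  have hball : ∀ v u u', u = v ∨ G.Adj v u → u' = v ∨ G.Adj v u' → x u ≠ 0 → x u' ≠ 0 →
      |x u| = |x u'| := by
    intro v u u' hu hu' hxu hxu'
    by_cases hv : x v = 0
    · have hvu : G.Adj u v := (hu.resolve_left fun e => hxu (e ▸ hv)).symm
      have hvu' : G.Adj u' v := (hu'.resolve_left fun e => hxu' (e ▸ hv)).symm
      obtain rfl | hne := eq_or_ne u u'
      · rfl
      · rw [hx.apply_eq_neg_of_adj_zero hG hvu hvu' hne hv hxu hxu', abs_neg]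
    · have hcentre : ∀ w, w = v ∨ G.Adj v w → x w ≠ 0 → |x v| = |x w| := by
        rintro w (rfl | hw) hxw
        · rfl
        · exact hedge v w hw hv hxw
      rw [← hcentre u hu hxu, ← hcentre u' hu' hxu']
  have hmem : L.indicator x ∈ eigsp G μ := indicator_mem_eigsp hx.prop.1 fun v => by
    by_cases hmeet : ∃ u, (u = v ∨ G.Adj v u) ∧ x u ≠ 0 ∧ u ∈ L
    · obtain ⟨u, hu, hxu, huL⟩ := hmeet
      exact .inl fun u' hu' hxu' => (hball v u' u hu' hu hxu' hxu).trans huL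
    · exact .inr fun u hu hxu huL => hmeet ⟨u, hu, hxu, huL⟩
  have hne : L.indicator x ≠ 0 := fun h0 => hr (by
    rw [← Set.indicator_of_mem (show r ∈ L from rfl) x, h0, Pi.zero_apply])
  have hsupp : support x ⊆ support (L.indicator x) :=
    hx.le_of_le ⟨hmem, hne⟩ (Set.support_indicator.trans_subset Set.inter_subset_right)
  exact (Set.mem_of_indicator_ne_zero (hsupp hs)).symm

lemma hasSimplyStructuredBasis_of_abs_eq_abs_of_adj (hG : G.IsAcyclic)
    (hedge : ∀ x ∈ eigsp G μ, ∀ u v, G.Adj u v → x u ≠ 0 → x v ≠ 0 → |x u| = |x v|) :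
    HasSimplyStructuredBasis G μ := by
  refine hasSimplyStructuredBasis_iff_span_eq.2
    (le_antisymm (Submodule.span_le.2 Set.inter_subset_left) ?_)
  nth_rewrite 1 [← span_isElementary (eigsp G μ)]
  refine Submodule.span_le.2 fun x (hx : IsElementary (eigsp G μ) x) => ?_
  obtain ⟨a, ha, hax⟩ := exists_smul_mem_signVectors
    fun u v hu hv => hx.abs_eq_abs hG (hedge x hx.prop.1) hu hv
  exact (Submodule.smul_mem_iff _ ha).1
    (Submodule.subset_span ⟨Submodule.smul_mem _ a hx.prop.1, hax⟩)

end ElementaryEigenvectors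

section Components

variable {V : Type*} [Finite V] {G : SimpleGraph V} {μ : ℝ} {x : V → ℝ}

lemma ne_zero_of_adj_of_notMem_alwaysZero (hG : G.IsAcyclic) (hx : x ∈ eigsp G μ) {u v : V}
    (h : G.Adj u v) (hv : v ∉ alwaysZero G μ) (hu : x u ≠ 0) : x v ≠ 0 := by
  obtain ⟨y, hy, hyv⟩ := notMem_alwaysZero_iff.1 hv
  have hprop := mul_eq_mul_of_isBridge (isAcyclic_iff_forall_adj_isBridge.1 hG h) h hx hy
  exact left_ne_zero_of_mul (hprop ▸ mul_ne_zero hu hyv)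

/-- The inclusion of a component of `G ∖ M` into `G`. -/
def componentEmbedding {V : Type*} {G : SimpleGraph V} {M : Set V}
    (C : (removeVerts G M).ConnectedComponent) : C.toSimpleGraph ↪g G :=
  (Embedding.induce Mᶜ).comp (Embedding.induce C.supp)

lemma comp_componentEmbedding_mem_eigsp
    (C : (removeVerts G (alwaysZero G μ)).ConnectedComponent) (hx : x ∈ eigsp G μ) :
    x ∘ componentEmbedding C ∈ eigsp C.toSimpleGraph μ := by
  refine mem_eigsp_iff.2 fun a => ?_
  rw [adjEnd_comp_embedding_apply, mem_eigsp_iff.1 hx, comp_apply]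
  intro v hav hv
  by_contra hxv
  let v' : ↥(alwaysZero G μ)ᶜ := ⟨v, notMem_alwaysZero_iff.2 ⟨x, hx, hxv⟩⟩
  have hadj : (removeVerts G (alwaysZero G μ)).Adj a.1 v' := hav
  exact hv ⟨⟨v', C.mem_supp_of_adj_mem_supp a.2 hadj⟩, rfl⟩

lemma ne_zero_on_component (hG : G.IsAcyclic)
    (C : (removeVerts G (alwaysZero G μ)).ConnectedComponent) (hx : x ∈ eigsp G μ) {r}
    (hr : x (componentEmbedding C r) ≠ 0) (a) : x (componentEmbedding C a) ≠ 0 := by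
  obtain ⟨p⟩ := C.connected_toSimpleGraph.preconnected r a
  induction p with
  | nil => exact hr
  | @cons _ w _ hadj _ ih =>
    exact ih (ne_zero_of_adj_of_notMem_alwaysZero hG hx hadj w.1.2 hr)

lemma inSignClass_component (hG : G.IsAcyclic) (h : HasSimplyStructuredBasis G μ)
    (C : (removeVerts G (alwaysZero G μ)).ConnectedComponent) :
    InSignClass C.toSimpleGraph μ := by
  refine ⟨(hG.induce _).isTree_connectedComponent C, ?_⟩
  obtain ⟨r⟩ := C.connected_toSimpleGraph.nonempty
  obtain ⟨x, ⟨hx, hsign⟩, hr⟩ : ∃ x ∈ (eigsp G μ ∩ signVectors V : Set (V → ℝ)), x r.1.1 ≠ 0 := by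
    by_contra! hzero
    obtain ⟨y, hy, hyr⟩ := notMem_alwaysZero_iff.1 r.1.2
    rw [← hasSimplyStructuredBasis_iff_span_eq.1 h] at hy
    have hle : Submodule.span ℝ (eigsp G μ ∩ signVectors V) ≤
      LinearMap.ker (LinearMap.proj (R := ℝ) (φ := fun _ => ℝ) r.1.1) := Submodule.span_le.2 hzero
    exact hyr (hle hy)
  have hne := ne_zero_on_component hG C hx hr
  exact ⟨x ∘ componentEmbedding C,
    ⟨comp_componentEmbedding_mem_eigsp C hx, fun h0 => hr (congrFun h0 r)⟩,
    fun a => (hsign a.1.1).resolve_left (hne a)⟩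

lemma InSignClass.abs_eq_abs (hG : InSignClass G μ) (hx : x ∈ eigsp G μ) {u v : V}
    (huv : G.Adj u v) : |x u| = |x v| := by
  obtain ⟨hT, z, hz, hsign⟩ := hG
  have habs : ∀ a, |z a| = 1 := fun a => by rcases hsign a with h | h <;> rw [h] <;> simp
  have hprop := congrArg abs (mul_eq_mul_of_isBridge
    (isAcyclic_iff_forall_adj_isBridge.1 hT.isAcyclic huv) huv hx hz.1)
  simpa only [abs_mul, habs, mul_one] using hprop

theorem hasSimplyStructuredBasis_iff_inSignClass (hG : G.IsAcyclic) :
    HasSimplyStructuredBasis G μ ↔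
      ∀ C : (removeVerts G (alwaysZero G μ)).ConnectedComponent,
        InSignClass C.toSimpleGraph μ := by
  refine ⟨inSignClass_component hG, fun hC => ?_⟩
  refine hasSimplyStructuredBasis_of_abs_eq_abs_of_adj hG fun x hx u v huv hu hv => ?_
  let u' : ↥(alwaysZero G μ)ᶜ := ⟨u, notMem_alwaysZero_iff.2 ⟨x, hx, hu⟩⟩
  let v' : ↥(alwaysZero G μ)ᶜ := ⟨v, notMem_alwaysZero_iff.2 ⟨x, hx, hv⟩⟩
  have hadj : (removeVerts G (alwaysZero G μ)).Adj u' v' := huv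
  let C := (removeVerts G (alwaysZero G μ)).connectedComponentMk u'
  have hu' : u' ∈ C.supp := ConnectedComponent.connectedComponentMk_mem
  have hadjC : C.toSimpleGraph.Adj ⟨u', hu'⟩ ⟨v', C.mem_supp_of_adj_mem_supp hu' hadj⟩ := hadj
  exact (hC C).abs_eq_abs (comp_componentEmbedding_mem_eigsp C hx) hadjC

end Components

section SignSymmetry

variable {V : Type*} [Finite V] {G : SimpleGraph V} {μ : ℝ} {x ε : V → ℝ}

lemma mul_mem_eigsp_neg (hε : ∀ u v, G.Adj u v → ε v = -ε u) (hx : x ∈ eigsp G μ) :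
    ε * x ∈ eigsp G (-μ) := by
  refine mem_eigsp_iff.2 fun v => ?_
  have hnbrs : ∀ u, G.Adj v u → (ε * x) u = (-ε v • x) u := fun u hu => by simp [hε v u hu]
  rw [adjEnd_apply_congr hnbrs, map_smul, Pi.smul_apply, mem_eigsp_iff.1 hx, Pi.mul_apply,
    smul_eq_mul]
  ring

lemma exists_signing_of_isBipartite {V R : Type*} [Ring R] {G : SimpleGraph V}
    (hG : G.IsBipartite) :
    ∃ ε : V → R, (∀ v, ε v = 1 ∨ ε v = -1) ∧ ∀ u v, G.Adj u v → ε v = -ε u := by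
  obtain ⟨c⟩ := hG
  refine ⟨fun v => if c v = 0 then 1 else -1, fun v => ite_eq_or_eq .., fun u v huv => ?_⟩
  have hc : c u ≠ c v := c.valid huv
  beta_reduce
  split_ifs <;> first | omega | simp

lemma HasSimplyStructuredBasis.neg (hG : G.IsBipartite) (h : HasSimplyStructuredBasis G μ) :
    HasSimplyStructuredBasis G (-μ) := by
  obtain ⟨ε, hsign, hε⟩ := exists_signing_of_isBipartite (R := ℝ) hG
  have hεε : ε * ε = 1 := funext fun v => by rcases hsign v with h | h <;> simp [h]
  have hmaps : ∀ x ∈ (eigsp G μ ∩ signVectors V : Set (V → ℝ)),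
      ε * x ∈ Submodule.span ℝ (eigsp G (-μ) ∩ signVectors V) := fun x hx =>
    Submodule.subset_span
      ⟨mul_mem_eigsp_neg hε hx.1, mul_mem_signVectors (fun v => .inr (hsign v)) hx.2⟩
  have hspan : eigsp G μ ≤
      (Submodule.span ℝ (eigsp G (-μ) ∩ signVectors V)).comap (LinearMap.mulLeft ℝ ε) :=
    (hasSimplyStructuredBasis_iff_span_eq.1 h).ge.trans (Submodule.span_le.2 hmaps)
  refine hasSimplyStructuredBasis_iff_span_eq.2
    (le_antisymm (Submodule.span_le.2 Set.inter_subset_left) fun x hx => ?_)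
  have hεx : ε * x ∈ eigsp G μ := neg_neg μ ▸ mul_mem_eigsp_neg hε hx
  simpa [← mul_assoc, hεε] using hspan hεx

lemma hasSimplyStructuredBasis_neg_iff (hG : G.IsBipartite) :
    HasSimplyStructuredBasis G (-μ) ↔ HasSimplyStructuredBasis G μ :=
  ⟨fun h => neg_neg μ ▸ h.neg hG, .neg hG⟩

end SignSymmetry

end TreeEigen

theorem mainTheorem4_general {V : Type*} [Finite V] {G : SimpleGraph V} (hG : G.IsAcyclic)
    (μ : ℝ) :
    (TreeEigen.HasSimplyStructuredBasis G μ ↔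
      ∀ C : (TreeEigen.removeVerts G (TreeEigen.alwaysZero G μ)).ConnectedComponent,
        TreeEigen.InSignClass C.toSimpleGraph μ) ∧
    (TreeEigen.HasSimplyStructuredBasis G (-μ) ↔
      ∀ C : (TreeEigen.removeVerts G (TreeEigen.alwaysZero G μ)).ConnectedComponent,
        TreeEigen.InSignClass C.toSimpleGraph μ) :=
  have hμ := TreeEigen.hasSimplyStructuredBasis_iff_inSignClass hG
  ⟨hμ, (TreeEigen.hasSimplyStructuredBasis_neg_iff hG.isBipartite).trans hμ⟩

theorem mainTheorem4 {V : Type*} [Finite V] (T : SimpleGraph V) (hT : T.IsTree) :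
    (Module.End.HasEigenvalue (TreeEigen.adjEnd T) 1 →
      (TreeEigen.HasSimplyStructuredBasis T 1 ↔
        ∀ C : (TreeEigen.removeVerts T (TreeEigen.alwaysZero T 1)).ConnectedComponent,
          TreeEigen.InClassC C.toSimpleGraph)) ∧
    (Module.End.HasEigenvalue (TreeEigen.adjEnd T) (-1) →
      (TreeEigen.HasSimplyStructuredBasis T (-1) ↔
        ∀ C : (TreeEigen.removeVerts T (TreeEigen.alwaysZero T 1)).ConnectedComponent,
          TreeEigen.InClassC C.toSimpleGraph) ∧
      (TreeEigen.HasSimplyStructuredBasis T (-1) ↔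
        ∀ C : (TreeEigen.removeVerts T (TreeEigen.alwaysZero T (-1))).ConnectedComponent,
          TreeEigen.InSignClass C.toSimpleGraph (-1))) := by
  have general := mainTheorem4_general hT.isAcyclic
  exact ⟨fun _ => (general 1).1, fun _ => ⟨(general 1).2, (general (-1)).1⟩⟩
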